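/- Let $\mathcal H=\mathcal H_a\otimes\mathcal H_b\otimes\mathcal H_c$ be a tripartite Hilbert space with finite dimensions $d_a,d_b,d_c\ge 1$, and consider the neighborhood structure $\mathcal N_{\rm tri}=\{\mathcal N_{ab},\mathcal N_{bc}\}$. Its neighborhood operators are those of the form $X_{ab}\otimes I_c$ or $I_a\otimes X_{bc}$. A pure state, given by a unit vector $|\psi\rangle\in\mathcal H$, is called *dissipatively quasi-locally stabilizable* (DQLS) relative to $\mathcal N_{\rm tri}$ if there are finitely many neighborhood operators $L_1,\dots,L_m$ with $L_k|\psi\rangle=0$ for all $k$ such that, for the Lindblad generator with zero Hamiltonian $$\mathcal L[\rho]=\sum_k\Big(L_k\rho L_k^\dagger-\tfrac12\{L_k^\dagger L_k,\rho\}\Big),$$ the state $|\psi\rangle\langle\psi|$ is globally asymptotically stable, i.e. $\mathcal L[|\psi\rangle\langle\psi|]=0$ and $\lim_{t\to\infty}e^{t\mathcal L}[\rho_0]=|\psi\rangle\langle\psi|$ for every density operator $\rho_0$ on $\mathcal H$. A property is said to hold for a generic pure state if it holds with probability one for a random pure state, i.e. for almost every unit vector of $\mathcal H$ with respect to the unitarily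 invariant probability measure (which induces the Fubini–Study measure on pure states). Assume $d_b>2$. Then a generic pure state in $\mathcal H$ is DQLS relative to $\mathcal N_{\rm tri}$ for each of the following combinations of dimensions $d_a\times d_b\times d_c$: 1. $d_a\times d_b\times d_a$; 2. $d_a\times d_b\times(d_a+1)$; 3. $d_a\times d_b\times n d_a$, for every integer $n$ with $1<n<d_b$. -/

import Mathlib

open MeasureTheory Matrix
open scoped Matrix Kronecker ComplexOrder

noncomputable section

namespace QuasiLocal

section Dynamics

variable {ι : Type*} [Fintype ι] [DecidableEq ι]

/-- The density operators: positive semidefinite matrices of trace one. -/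
def IsDensity (ρ : Matrix ι ι ℂ) : Prop :=
  ρ.PosSemidef ∧ ρ.trace = 1

/-- The rank-one operator `|ψ⟩⟨ψ|`. -/
def pureState (ψ : EuclideanSpace ℂ ι) : Matrix ι ι ℂ :=
  Matrix.of fun x y => ψ x * star (ψ y)

/-- The generator `𝓛(H, {L_k})` in Gorini-Kossakowski-Sudarshan-Lindblad form,
`ρ ↦ -i[H, ρ] + ∑ₖ (Lₖ ρ Lₖ† - ½ {Lₖ† Lₖ, ρ})`. -/
def lindbladian {m : ℕ} (H : Matrix ι ι ℂ) (L : Fin m → Matrix ι ι ℂ) :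
    Matrix ι ι ℂ →ₗ[ℂ] Matrix ι ι ℂ where
  toFun ρ := (-Complex.I) • (H * ρ - ρ * H) +
    ∑ k, (L k * ρ * (L k)ᴴ - (1 / 2 : ℂ) • ((L k)ᴴ * L k * ρ + ρ * ((L k)ᴴ * L k)))
  map_add' ρ σ := by
    simp only [mul_add, add_mul, smul_add, smul_sub, Finset.sum_add_distrib,
      Finset.sum_sub_distrib]
    abel
  map_smul' c ρ := by
    simp only [Matrix.mul_smul, Matrix.smul_mul, RingHom.id_apply, smul_add, smul_sub,
      Finset.smul_sum, smul_comm c]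

/-- The time evolution `e^{t𝓛}[ρ]`, as the exponential series `∑ₖ (tᵏ / k!) 𝓛ᵏ[ρ]`
(which always converges, the space being finite-dimensional). -/
def evolve (𝓛 : Matrix ι ι ℂ →ₗ[ℂ] Matrix ι ι ℂ) (t : ℝ) (ρ : Matrix ι ι ℂ) : Matrix ι ι ℂ :=
  ∑' k : ℕ, ((t : ℂ) ^ k / (k.factorial : ℂ)) • (𝓛 ^ k) ρ

/-- `ρd` is globally asymptotically stable for the semigroup generated by `𝓛`: it is invariant, and
every initial density operator converges to it. -/
def IsGAS (𝓛 : Matrix ι ι ℂ →ₗ[ℂ] Matrix ι ι ℂ) (ρd : Matrix ι ι ℂ) : Prop :=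
  𝓛 ρd = 0 ∧
    ∀ ρ₀ : Matrix ι ι ℂ, IsDensity ρ₀ →
      Filter.Tendsto (fun t : ℝ => evolve 𝓛 t ρ₀) Filter.atTop (nhds ρd)

/-- The pure state `ψ` is dissipatively quasi-locally stabilizable relative to `𝒩`.
A neighborhood structure enters through the collection `𝒩` of its sets of neighborhood operators,
one set `{X ⊗ I}` for each neighborhood. The requirement is that there be a quasi-local generator in
standard form with zero Hamiltonian, that is finitely many Lindblad operators, each of them a
neighborhood operator (for some neighborhood) and each annihilating `ψ`, for which
`|ψ⟩⟨ψ|` is globally asymptotically stable. -/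
def IsDQLS (𝒩 : Set (Set (Matrix ι ι ℂ))) (ψ : EuclideanSpace ℂ ι) : Prop :=
  ∃ (m : ℕ) (L : Fin m → Matrix ι ι ℂ),
    (∀ k, ∃ 𝒜 ∈ 𝒩, L k ∈ 𝒜) ∧
    (∀ k, L k *ᵥ WithLp.ofLp ψ = 0) ∧
    IsGAS (lindbladian 0 L) (pureState ψ)

/-- The uniform probability distribution on unit vectors: the surface measure of the unit sphere
of the Hilbert space, normalized to total mass one. It is the unitarily invariant probability
measure on unit vectors, which induces the Fubini-Study measure on pure states. -/
def randomPureState (ι : Type*) [Fintype ι] :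
    Measure (Metric.sphere (0 : EuclideanSpace ℂ ι) 1) :=
  ((volume : Measure (EuclideanSpace ℂ ι)).toSphere Set.univ)⁻¹ •
    (volume : Measure (EuclideanSpace ℂ ι)).toSphere

end Dynamics

section Tripartite

variable (a b c : Type*) [DecidableEq a] [DecidableEq c]

/-- Neighborhood operators `X_{ab} ⊗ I_c` on `ℂᵃ ⊗ ℂᵇ ⊗ ℂᶜ`. -/
def opsAB : Set (Matrix (a × b × c) (a × b × c) ℂ) :=
  {M | ∃ X : Matrix (a × b) (a × b) ℂ,
    M = (X ⊗ₖ (1 : Matrix c c ℂ)).submatrix (Equiv.prodAssoc a b c).symm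
      (Equiv.prodAssoc a b c).symm}

/-- Neighborhood operators `I_a ⊗ X_{bc}` on `ℂᵃ ⊗ ℂᵇ ⊗ ℂᶜ`. -/
def opsBC : Set (Matrix (a × b × c) (a × b × c) ℂ) :=
  {M | ∃ X : Matrix (b × c) (b × c) ℂ, M = (1 : Matrix a a ℂ) ⊗ₖ X}

/-- The tripartite neighborhood structure `{𝒩_ab, 𝒩_bc}`. -/
def nTri : Set (Set (Matrix (a × b × c) (a × b × c) ℂ)) :=
  {opsAB a b c, opsBC a b c}

end Tripartite

/-- A generic pure state of `ℂ^da ⊗ ℂ^db ⊗ ℂ^dc` is DQLS relative to `{𝒩_ab, 𝒩_bc}`: the DQLS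
pure states have probability one. -/
def GenericallyDQLS (da db dc : ℕ) : Prop :=
  ∀ᵐ ψ ∂randomPureState (Fin da × Fin db × Fin dc),
    IsDQLS (nTri (Fin da) (Fin db) (Fin dc)) ψ.1

end QuasiLocal

end

/-!
A vector `ψ` is stabilized as soon as some local Lindblad operators annihilate it, generate a map that
is positive up to a scalar, and pump every vector orthogonal to `ψ` towards `ψ`
(`isGAS_of_reach`): writing the generator as `E - c` with `E` positive, the infidelity shrinks under
each application of `E` by a fixed factor relative to the trace, hence decays exponentially under
`e^{-ct} ∑ tᵏ Eᵏ / k!`. For each neighborhood such operators are `R` and multiples of `|x⟩⟨y| R`,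
where `R` projects onto the orthogonal complement of the support of the reduced state; with the right
normalization their dissipators add up to a completely positive map minus the identity, without a
Hamiltonian term (`exists_local_dissipators`).

The vectors that are pumped nowhere are those lying in both extended supports, that is, those of the
form `(Y ⊗ 1) ψ = (1 ⊗ X) ψ`. Slicing `ψ` along the middle factor into matrices `T j`, they correspond
to the pairs with `Y * T j = T j * X` for all `j`: the endomorphisms of a representation of the
generalized Kronecker quiver. So `ψ` is stabilizable if this representation is a brick
(`IsBrick.isDQLS`), which moreover forces the reduced states on the two outer factors to have full
rank.

Being a brick is the injectivity of a linear map depending linearly on `ψ`, so that the existence of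
one brick implies that almost every tensor is a brick (`ae_isBrick`), and it remains to write down a
brick for each of the three families of dimensions.
-/

noncomputable section

namespace QuasiLocal

/-! ### Positive semidefinite matrices -/

section PosSemidef

variable {ι : Type*} [Fintype ι]

lemma isClosed_setOf_posSemidef : IsClosed {A : Matrix ι ι ℂ | A.PosSemidef} := by
  have h : {A : Matrix ι ι ℂ | A.PosSemidef} =
      {A | Aᴴ = A} ∩ ⋂ x : ι → ℂ, {A | 0 ≤ star x ⬝ᵥ (A *ᵥ x)} := by
    ext A
    simp only [Set.mem_ofPred_eq, Set.mem_inter_iff, Set.mem_iInter]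
    exact posSemidef_iff_dotProduct_mulVec
  rw [h]
  refine (isClosed_eq (by fun_prop) continuous_id).inter (isClosed_iInter fun x => ?_)
  exact isClosed_le continuous_const (by fun_prop)

open scoped MatrixOrder Matrix.Norms.L2Operator in
lemma exists_eq_conjTranspose_mul_self [DecidableEq ι] {A : Matrix ι ι ℂ} (hA : A.PosSemidef) :
    ∃ B : Matrix ι ι ℂ, A = Bᴴ * B :=
  CStarAlgebra.nonneg_iff_eq_star_mul_self.mp hA.nonneg

lemma trace_mul_nonneg_of_posSemidef [DecidableEq ι] {A B : Matrix ι ι ℂ} (hA : A.PosSemidef)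
    (hB : B.PosSemidef) : 0 ≤ (A * B).trace := by
  obtain ⟨C, rfl⟩ := exists_eq_conjTranspose_mul_self hB
  rw [← Matrix.mul_assoc, trace_mul_comm, ← Matrix.mul_assoc]
  exact (hA.mul_mul_conjTranspose_same C).trace_nonneg

lemma exists_pos_sub_smul_one_posSemidef [DecidableEq ι] {N : Matrix ι ι ℂ} (hN : N.PosDef) :
    ∃ ε : ℝ, 0 < ε ∧ (N - (ε : ℂ) • (1 : Matrix ι ι ℂ)).PosSemidef := by
  obtain ⟨ε, hε, hle⟩ : ∃ ε : ℝ, 0 < ε ∧ ∀ i, ε ≤ hN.isHermitian.eigenvalues i := by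
    rcases isEmpty_or_nonempty ι with h | h
    · exact ⟨1, one_pos, fun i => (h.false i).elim⟩
    · obtain ⟨i, hi⟩ := Finite.exists_min hN.isHermitian.eigenvalues
      exact ⟨_, hN.eigenvalues_pos i, hi⟩
  refine ⟨ε, hε, ?_⟩
  set U := hN.isHermitian.eigenvectorUnitary
  have h1 : N - (ε : ℂ) • (1 : Matrix ι ι ℂ) = (U : Matrix ι ι ℂ) *
      diagonal (fun i => ((hN.isHermitian.eigenvalues i - ε : ℝ) : ℂ)) *
        (U : Matrix ι ι ℂ)ᴴ := by
    have hd : diagonal (fun i => ((hN.isHermitian.eigenvalues i - ε : ℝ) : ℂ)) =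
        diagonal (RCLike.ofReal ∘ hN.isHermitian.eigenvalues) - (ε : ℂ) • (1 : Matrix ι ι ℂ) := by
      ext i j
      by_cases hij : i = j <;> simp [diagonal, hij]
    have hU : (U : Matrix ι ι ℂ) * (U : Matrix ι ι ℂ)ᴴ = 1 := Unitary.mul_star_self_of_mem U.2
    have hs := hN.isHermitian.spectral_theorem
    rw [Unitary.conjStarAlgAut_apply] at hs
    rw [hd, mul_sub, sub_mul, Matrix.mul_smul, Matrix.smul_mul, mul_one, hU]
    exact congrArg (· - _) hs
  rw [h1]
  refine PosSemidef.mul_mul_conjTranspose_same (PosSemidef.diagonal fun i => ?_) _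
  exact Complex.zero_le_real.2 (sub_nonneg.2 (hle i))

end PosSemidef

/-! ### Rank-one projections -/

section PureState

variable {ι : Type*}

lemma pureState_eq_vecMulVec (ψ : EuclideanSpace ℂ ι) :
    pureState ψ = vecMulVec (WithLp.ofLp ψ) (star (WithLp.ofLp ψ)) := rfl

lemma pureState_isHermitian (ψ : EuclideanSpace ℂ ι) : (pureState ψ)ᴴ = pureState ψ := by
  simp [pureState_eq_vecMulVec, conjTranspose_vecMulVec]

variable [Fintype ι]

lemma star_dotProduct_self {ψ : EuclideanSpace ℂ ι} (hψ : ‖ψ‖ = 1) :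
    star (WithLp.ofLp ψ) ⬝ᵥ WithLp.ofLp ψ = 1 := by
  have := inner_self_eq_norm_sq_to_K (𝕜 := ℂ) ψ
  rw [EuclideanSpace.inner_eq_star_dotProduct, hψ, dotProduct_comm] at this
  simpa using this

lemma pureState_posSemidef (ψ : EuclideanSpace ℂ ι) : (pureState ψ).PosSemidef :=
  posSemidef_vecMulVec_self_star _

lemma trace_pureState {ψ : EuclideanSpace ℂ ι} (hψ : ‖ψ‖ = 1) : (pureState ψ).trace = 1 := by
  rw [pureState_eq_vecMulVec, trace_vecMulVec, dotProduct_comm, star_dotProduct_self hψ]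

lemma pureState_mul_self {ψ : EuclideanSpace ℂ ι} (hψ : ‖ψ‖ = 1) :
    pureState ψ * pureState ψ = pureState ψ := by
  rw [pureState_eq_vecMulVec, vecMulVec_mul_vecMulVec, star_dotProduct_self hψ]
  simp

lemma mul_pureState_eq_zero {ψ : EuclideanSpace ℂ ι} {A : Matrix ι ι ℂ}
    (hA : A *ᵥ WithLp.ofLp ψ = 0) : A * pureState ψ = 0 := by
  rw [pureState_eq_vecMulVec, mul_vecMulVec, hA, zero_vecMulVec]

lemma pureState_mul_conjTranspose_eq_zero {ψ : EuclideanSpace ℂ ι} {A : Matrix ι ι ℂ}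
    (hA : A *ᵥ WithLp.ofLp ψ = 0) : pureState ψ * Aᴴ = 0 := by
  have := congrArg conjTranspose (mul_pureState_eq_zero hA)
  simpa [conjTranspose_mul, pureState_isHermitian] using this

end PureState

section Frobenius

attribute [local instance] Matrix.frobeniusNormedAddCommGroup Matrix.frobeniusNormedSpace

variable {ι : Type*} [Fintype ι]

lemma frobenius_norm_sq (A : Matrix ι ι ℂ) : ‖A‖ ^ 2 = (Aᴴ * A).trace.re := by
  rw [frobenius_norm_def, ← Real.sqrt_eq_rpow, Real.sq_sqrt (by positivity)]
  simp only [trace, diag_apply, mul_apply, conjTranspose_apply, Complex.re_sum]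
  rw [Finset.sum_comm]
  refine Finset.sum_congr rfl fun i _ => Finset.sum_congr rfl fun j _ => ?_
  rw [RCLike.star_def, ← Complex.normSq_eq_conj_mul_self, Complex.ofReal_re,
    Complex.normSq_eq_norm_sq]
  norm_num

/-- A state whose fidelity with `ψ` is close to one is close to `|ψ⟩⟨ψ|`, because
`‖σ‖₂ ≤ tr σ = 1` for positive `σ`. -/
lemma norm_sub_pureState_sq_le [DecidableEq ι] {ψ : EuclideanSpace ℂ ι} (hψ : ‖ψ‖ = 1)
    {σ : Matrix ι ι ℂ} (hσ : IsDensity σ) :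
    ‖σ - pureState ψ‖ ^ 2 ≤ 2 * (1 - (pureState ψ * σ).trace.re) := by
  have hσn : ‖σ‖ ≤ 1 := by
    obtain ⟨B, hB⟩ := exists_eq_conjTranspose_mul_self hσ.1
    have h1 : ‖B‖ ^ 2 = 1 := by rw [frobenius_norm_sq, ← hB, hσ.2, Complex.one_re]
    calc ‖σ‖ ≤ ‖Bᴴ‖ * ‖B‖ := hB ▸ frobenius_norm_mul _ _
      _ = 1 := by rw [frobenius_norm_conjTranspose, ← sq, h1]
  have hσ2 : (σ * σ).trace.re ≤ 1 := by
    have := frobenius_norm_sq σ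
    rw [hσ.1.isHermitian.eq] at this
    rw [← this]
    exact pow_le_one₀ (norm_nonneg _) hσn
  rw [frobenius_norm_sq, conjTranspose_sub, hσ.1.isHermitian.eq, pureState_isHermitian,
    sub_mul, mul_sub, mul_sub, pureState_mul_self hψ]
  simp only [trace_sub, trace_mul_comm σ (pureState ψ), Complex.sub_re, trace_pureState hψ,
    Complex.one_re]
  linarith

end Frobenius

lemma posSemidef_pow_apply {ι : Type*} {E : Matrix ι ι ℂ →ₗ[ℂ] Matrix ι ι ℂ}
    (hE : ∀ ρ : Matrix ι ι ℂ, ρ.PosSemidef → (E ρ).PosSemidef) {ρ : Matrix ι ι ℂ}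
    (hρ : ρ.PosSemidef) (k : ℕ) : ((E ^ k) ρ).PosSemidef := by
  induction k with
  | zero => simpa using hρ
  | succ k ih => rw [pow_succ', Module.End.mul_apply]; exact hE _ ih

/-! ### The evolution generated by a Lindbladian -/

section Evolution

variable {ι : Type*} [Fintype ι] [DecidableEq ι]

/-- Splitting off the scalar part `-c` of `A` turns the exponential series of `t A` into one in
`A + c`. -/
lemma hasSum_pow_add_smul_one {E : Type*} [NormedAddCommGroup E] [NormedSpace ℂ E]
    [FiniteDimensional ℂ E] (A : E →ₗ[ℂ] E) (c t : ℂ) (x : E) :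
    HasSum (fun k : ℕ => (t ^ k / (k.factorial : ℂ)) • ((A + c • 1) ^ k) x)
      (Complex.exp (c * t) • ∑' k : ℕ, (t ^ k / (k.factorial : ℂ)) • (A ^ k) x) := by
  have : CompleteSpace E := FiniteDimensional.complete ℂ E
  let _ : NormedAlgebra ℚ (E →L[ℂ] E) := NormedAlgebra.restrictScalars ℚ ℂ _
  let Φ := Module.End.toContinuousLinearMap (𝕜 := ℂ) E
  have key : ∀ B : E →ₗ[ℂ] E,
      HasSum (fun k : ℕ => (t ^ k / (k.factorial : ℂ)) • (B ^ k) x)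
        (NormedSpace.exp (Φ (t • B)) x) := by
    intro B
    have h := (NormedSpace.exp_series_hasSum_exp' (𝕂 := ℂ) (Φ (t • B))).mapL
      (ContinuousLinearMap.apply ℂ E x)
    refine h.congr_fun ?_
    intro k
    rw [← map_pow, smul_pow, map_smul, ContinuousLinearMap.apply_apply, map_smul, div_eq_inv_mul,
      mul_smul]
    rfl
  have hc : Φ (t • (A + c • 1)) = algebraMap ℂ (E →L[ℂ] E) (c * t) + Φ (t • A) := by
    rw [smul_add, map_add, add_comm, smul_smul, mul_comm t, map_smul, map_one,
      Algebra.algebraMap_eq_smul_one]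
  have h := key (A + c • 1)
  rw [hc, NormedSpace.exp_add_of_commute (Algebra.commutes _ _),
    ← NormedSpace.algebraMap_exp_comm, Algebra.algebraMap_eq_smul_one] at h
  rw [(key A).tsum_eq, Complex.exp_eq_exp_ℂ]
  simpa using h

omit [DecidableEq ι] in
lemma hasSum_evolve (𝓛 : Matrix ι ι ℂ →ₗ[ℂ] Matrix ι ι ℂ) (c t : ℝ) (ρ : Matrix ι ι ℂ) :
    HasSum (fun k : ℕ => ((t ^ k / k.factorial : ℝ) : ℂ) • ((𝓛 + (c : ℂ) • 1) ^ k) ρ)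
      (((Real.exp (c * t) : ℝ) : ℂ) • evolve 𝓛 t ρ) := by
  let _ : NormedAddCommGroup (Matrix ι ι ℂ) := Matrix.frobeniusNormedAddCommGroup
  let _ : NormedSpace ℂ (Matrix ι ι ℂ) := Matrix.frobeniusNormedSpace
  push_cast
  exact hasSum_pow_add_smul_one 𝓛 c t ρ

variable {m : ℕ} (L : Fin m → Matrix ι ι ℂ)

lemma lindbladian_zero_apply (ρ : Matrix ι ι ℂ) : lindbladian 0 L ρ =
    ∑ k, (L k * ρ * (L k)ᴴ - (1 / 2 : ℂ) • ((L k)ᴴ * L k * ρ + ρ * ((L k)ᴴ * L k))) := by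
  simp [lindbladian]

lemma trace_lindbladian_zero (ρ : Matrix ι ι ℂ) : (lindbladian 0 L ρ).trace = 0 := by
  rw [lindbladian_zero_apply, trace_sum]
  refine Finset.sum_eq_zero fun k _ => ?_
  rw [trace_sub, trace_smul, trace_add, trace_mul_comm ρ, trace_mul_cycle, smul_eq_mul]
  ring

variable {L} {ψ : EuclideanSpace ℂ ι}

lemma lindbladian_zero_pureState (hL : ∀ k, L k *ᵥ WithLp.ofLp ψ = 0) :
    lindbladian 0 L (pureState ψ) = 0 := by
  rw [lindbladian_zero_apply]
  refine Finset.sum_eq_zero fun k _ => ?_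
  rw [mul_pureState_eq_zero (hL k), Matrix.mul_assoc, mul_pureState_eq_zero (hL k),
    ← Matrix.mul_assoc, pureState_mul_conjTranspose_eq_zero (hL k)]
  simp

lemma trace_pureState_mul_lindbladian (hL : ∀ k, L k *ᵥ WithLp.ofLp ψ = 0) (ρ : Matrix ι ι ℂ) :
    (pureState ψ * lindbladian 0 L ρ).trace = ((∑ k, (L k)ᴴ * pureState ψ * L k) * ρ).trace := by
  rw [lindbladian_zero_apply, Finset.mul_sum, trace_sum, Finset.sum_mul, trace_sum]
  refine Finset.sum_congr rfl fun k _ => ?_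
  have h1 : pureState ψ * ((L k)ᴴ * L k * ρ) = 0 := by
    rw [← Matrix.mul_assoc, ← Matrix.mul_assoc, pureState_mul_conjTranspose_eq_zero (hL k)]
    simp
  have h2 : (pureState ψ * (ρ * ((L k)ᴴ * L k))).trace = 0 := by
    rw [trace_mul_comm, Matrix.mul_assoc, Matrix.mul_assoc, mul_pureState_eq_zero (hL k)]
    simp
  rw [mul_sub, Matrix.mul_smul, mul_add, h1, zero_add, trace_sub, trace_smul, h2, smul_zero,
    sub_zero, ← Matrix.mul_assoc, trace_mul_comm, ← Matrix.mul_assoc, ← Matrix.mul_assoc]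

/-- If every vector orthogonal to `ψ` can be sent to a vector with a component along `ψ` by some
Lindblad operator, then the rate at which population flows into `ψ` is bounded below. -/
lemma exists_pos_le_trace_pureState_mul_lindbladian (hψ : ‖ψ‖ = 1)
    (hL : ∀ k, L k *ᵥ WithLp.ofLp ψ = 0)
    (hreach : ∀ φ : ι → ℂ, φ ≠ 0 → star (WithLp.ofLp ψ) ⬝ᵥ φ = 0 →
      ∃ k, star (WithLp.ofLp ψ) ⬝ᵥ (L k *ᵥ φ) ≠ 0) :
    ∃ ε : ℝ, 0 < ε ∧ ∀ ρ : Matrix ι ι ℂ, ρ.PosSemidef →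
      ε * (ρ.trace - (pureState ψ * ρ).trace).re ≤ (pureState ψ * lindbladian 0 L ρ).trace.re := by
  set P := pureState ψ with hP
  set M := ∑ k, (L k)ᴴ * P * L k with hM
  have hMterm : ∀ k, ((L k)ᴴ * P * L k).PosSemidef := fun k =>
    (pureState_posSemidef ψ).conjTranspose_mul_mul_same _
  have hMpsd : M.PosSemidef := posSemidef_sum _ fun k _ => hMterm k
  have quad : ∀ φ : ι → ℂ, star φ ⬝ᵥ (P *ᵥ φ) =
      ((‖star (WithLp.ofLp ψ) ⬝ᵥ φ‖ ^ 2 : ℝ) : ℂ) := by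
    intro φ
    rw [hP, pureState_eq_vecMulVec, vecMulVec_mulVec, Complex.ofReal_pow, ← Complex.conj_mul',
      ← RCLike.star_def, ← star_dotProduct_star, star_star]
    rw [dotProduct_smul, MulOpposite.smul_eq_mul_unop, MulOpposite.unop_op]
  have hN : (M + P).PosDef := by
    refine PosDef.of_dotProduct_mulVec_pos
      (hMpsd.isHermitian.add (pureState_posSemidef ψ).isHermitian) fun φ hφ => ?_
    rw [add_mulVec, dotProduct_add]
    have hM0 := hMpsd.dotProduct_mulVec_nonneg φ
    have hP0 := (pureState_posSemidef ψ).dotProduct_mulVec_nonneg φ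
    by_cases h0 : star (WithLp.ofLp ψ) ⬝ᵥ φ = 0
    · obtain ⟨k, hk⟩ := hreach φ hφ h0
      refine add_pos_of_pos_of_nonneg ?_ hP0
      rw [hM, sum_mulVec, dotProduct_sum]
      refine Finset.sum_pos' (fun j _ => (hMterm j).dotProduct_mulVec_nonneg φ)
        ⟨k, Finset.mem_univ _, ?_⟩
      have : star φ ⬝ᵥ (((L k)ᴴ * P * L k) *ᵥ φ) = star (L k *ᵥ φ) ⬝ᵥ (P *ᵥ (L k *ᵥ φ)) := by
        rw [star_mulVec, ← mulVec_mulVec, ← mulVec_mulVec, dotProduct_mulVec]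
      rw [this, quad]
      exact_mod_cast pow_pos (norm_pos_iff.2 hk) 2
    · refine add_pos_of_nonneg_of_pos hM0 ?_
      rw [quad]
      exact_mod_cast pow_pos (norm_pos_iff.2 h0) 2
  obtain ⟨ε, hε, hNε⟩ := exists_pos_sub_smul_one_posSemidef hN
  refine ⟨ε, hε, fun ρ hρ => ?_⟩
  have hPP : P * P = P := pureState_mul_self hψ
  have hMP : M * P = 0 := by
    rw [hM, Finset.sum_mul]
    refine Finset.sum_eq_zero fun k _ => ?_
    rw [Matrix.mul_assoc, mul_pureState_eq_zero (hL k), Matrix.mul_zero]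
  have hPM : P * M = 0 := by
    have := congrArg conjTranspose hMP
    rwa [conjTranspose_mul, hMpsd.isHermitian.eq, pureState_isHermitian, conjTranspose_zero] at this
  have hQ : (M - (ε : ℂ) • (1 - P)).PosSemidef := by
    have h := hNε.mul_mul_conjTranspose_same (1 - P)
    rw [conjTranspose_sub, pureState_isHermitian, conjTranspose_one] at h
    convert h using 1
    rw [← hP]
    simp only [sub_mul, mul_sub, mul_add, add_mul, Matrix.one_mul, Matrix.mul_one, hPP, hMP, hPM,
      Matrix.mul_smul, Matrix.smul_mul, Matrix.zero_mul]
    module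
  have h := trace_mul_nonneg_of_posSemidef hQ hρ
  rw [trace_pureState_mul_lindbladian hL]
  have h' := (Complex.le_def.1 h).1
  simp only [sub_mul, Matrix.one_mul, Matrix.smul_mul, trace_sub, trace_smul, Complex.sub_re,
    smul_eq_mul, Complex.re_ofReal_mul, Complex.zero_re] at h' ⊢
  linarith

/-- The infidelity `tr ρ - ⟨ψ|ρ|ψ⟩` of `ρ` with respect to `ψ`. -/
def infidelity (ψ : EuclideanSpace ℂ ι) : Matrix ι ι ℂ →+ ℝ where
  toFun ρ := (ρ.trace - (pureState ψ * ρ).trace).re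
  map_zero' := by simp
  map_add' ρ σ := by simp [mul_add]; ring

lemma infidelity_apply (ρ : Matrix ι ι ℂ) :
    infidelity ψ ρ = (ρ.trace - (pureState ψ * ρ).trace).re := rfl

lemma continuous_infidelity : Continuous (infidelity ψ) := by
  change Continuous fun ρ : Matrix ι ι ℂ => (ρ.trace - (pureState ψ * ρ).trace).re
  fun_prop

lemma infidelity_smul (r : ℝ) (ρ : Matrix ι ι ℂ) :
    infidelity ψ ((r : ℂ) • ρ) = r * infidelity ψ ρ := by
  simp only [infidelity_apply, trace_smul, Matrix.mul_smul, smul_eq_mul, Complex.sub_re,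
    Complex.re_ofReal_mul]
  ring

omit [DecidableEq ι] in
lemma continuous_trace : Continuous (traceAddMonoidHom ι ℂ) :=
  continuous_id.matrix_trace

omit [DecidableEq ι] in
lemma isDensity_evolve {𝓛 : Matrix ι ι ℂ →ₗ[ℂ] Matrix ι ι ℂ} (htr : ∀ ρ, (𝓛 ρ).trace = 0) {c : ℝ}
    (hpos : ∀ ρ : Matrix ι ι ℂ, ρ.PosSemidef → ((𝓛 + (c : ℂ) • 1) ρ).PosSemidef)
    {ρ : Matrix ι ι ℂ} (hρ : IsDensity ρ) {t : ℝ} (ht : 0 ≤ t) : IsDensity (evolve 𝓛 t ρ) := by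
  have hs := hasSum_evolve 𝓛 c t ρ
  have hEtr : ∀ k : ℕ, (((𝓛 + (c : ℂ) • 1) ^ k) ρ).trace = (c : ℂ) ^ k := by
    intro k
    induction k with
    | zero => simpa using hρ.2
    | succ k ih =>
      rw [pow_succ', Module.End.mul_apply, LinearMap.add_apply, LinearMap.smul_apply,
        Module.End.one_apply, trace_add, htr, trace_smul, ih, zero_add, smul_eq_mul, pow_succ']
  constructor
  · have h : (((Real.exp (c * t) : ℝ) : ℂ) • evolve 𝓛 t ρ).PosSemidef := by
      refine isClosed_setOf_posSemidef.mem_of_tendsto hs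
        (Filter.Eventually.of_forall fun s => posSemidef_sum s fun k _ => ?_)
      refine (posSemidef_pow_apply hpos hρ.1 k).smul ?_
      have : (0 : ℝ) ≤ t ^ k / k.factorial := by positivity
      exact_mod_cast this
    have h' := h.smul (a := (((Real.exp (c * t))⁻¹ : ℝ) : ℂ))
      (by exact_mod_cast (inv_pos.2 (Real.exp_pos _)).le)
    rwa [smul_smul, ← Complex.ofReal_mul, inv_mul_cancel₀ (Real.exp_pos _).ne',
      Complex.ofReal_one, one_smul] at h'
  · have h := hs.map (traceAddMonoidHom ι ℂ) continuous_trace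
    have h2 : HasSum (fun k : ℕ => ((c : ℂ) * t) ^ k / (k.factorial : ℂ))
        (Complex.exp (c * t)) := by
      rw [Complex.exp_eq_exp_ℂ]
      exact NormedSpace.expSeries_div_hasSum_exp _
    have h3 := h.unique (h2.congr_fun fun k => ?_)
    · rw [traceAddMonoidHom_apply, trace_smul, smul_eq_mul, Complex.ofReal_exp,
        Complex.ofReal_mul] at h3
      exact mul_left_cancel₀ (Complex.exp_ne_zero _) (h3.trans (mul_one _).symm)
    · rw [Function.comp_apply, traceAddMonoidHom_apply, trace_smul, hEtr, smul_eq_mul, mul_pow]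
      push_cast
      ring

lemma infidelity_evolve_le {𝓛 : Matrix ι ι ℂ →ₗ[ℂ] Matrix ι ι ℂ} {c ε : ℝ} (hεc : ε ≤ c)
    (hpos : ∀ ρ : Matrix ι ι ℂ, ρ.PosSemidef → ((𝓛 + (c : ℂ) • 1) ρ).PosSemidef)
    (hrate : ∀ ρ : Matrix ι ι ℂ, ρ.PosSemidef → infidelity ψ (𝓛 ρ) ≤ -(ε * infidelity ψ ρ))
    {ρ : Matrix ι ι ℂ} (hρ : ρ.PosSemidef) {t : ℝ} (ht : 0 ≤ t) :
    infidelity ψ (evolve 𝓛 t ρ) ≤ Real.exp (-(ε * t)) * infidelity ψ ρ := by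
  set E := 𝓛 + (c : ℂ) • 1 with hE
  have hEq : ∀ k : ℕ, infidelity ψ ((E ^ k) ρ) ≤ (c - ε) ^ k * infidelity ψ ρ := by
    intro k
    induction k with
    | zero => simp
    | succ k ih =>
      have h1 := hrate _ (posSemidef_pow_apply hpos hρ k)
      have h2 : infidelity ψ ((E ^ (k + 1)) ρ) = infidelity ψ (𝓛 ((E ^ k) ρ)) +
          c * infidelity ψ ((E ^ k) ρ) := by
        rw [pow_succ', Module.End.mul_apply, ← infidelity_smul, ← map_add]
        rfl
      calc infidelity ψ ((E ^ (k + 1)) ρ) ≤ (c - ε) * infidelity ψ ((E ^ k) ρ) := by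
            rw [h2, sub_mul]; linarith
        _ ≤ (c - ε) * ((c - ε) ^ k * infidelity ψ ρ) :=
          mul_le_mul_of_nonneg_left ih (sub_nonneg.2 hεc)
        _ = (c - ε) ^ (k + 1) * infidelity ψ ρ := by ring
  have h1 : HasSum (fun k : ℕ => t ^ k / k.factorial * infidelity ψ ((E ^ k) ρ))
      (Real.exp (c * t) * infidelity ψ (evolve 𝓛 t ρ)) := by
    rw [← infidelity_smul]
    refine ((hasSum_evolve 𝓛 c t ρ).map (infidelity ψ) continuous_infidelity).congr_fun fun k => ?_
    rw [Function.comp_apply, infidelity_smul]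
  have h2 : HasSum (fun k : ℕ => ((c - ε) * t) ^ k / (k.factorial : ℝ) * infidelity ψ ρ)
      (Real.exp ((c - ε) * t) * infidelity ψ ρ) := by
    have h := NormedSpace.expSeries_div_hasSum_exp ((c - ε) * t)
    rw [← Real.exp_eq_exp_ℝ] at h
    exact h.mul_right _
  have h3 : Real.exp (c * t) * infidelity ψ (evolve 𝓛 t ρ) ≤
      Real.exp ((c - ε) * t) * infidelity ψ ρ := by
    refine hasSum_le (fun k => ?_) h1 h2
    rw [mul_pow]
    calc t ^ k / k.factorial * infidelity ψ ((E ^ k) ρ)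
        ≤ t ^ k / k.factorial * ((c - ε) ^ k * infidelity ψ ρ) :=
          mul_le_mul_of_nonneg_left (hEq k) (by positivity)
      _ = _ := by ring
  have h4 : Real.exp ((c - ε) * t) = Real.exp (c * t) * Real.exp (-(ε * t)) := by
    rw [← Real.exp_add]; ring_nf
  rw [h4, mul_assoc] at h3
  exact le_of_mul_le_mul_left h3 (Real.exp_pos _)

/-- A generator that is a positive map up to a scalar stabilizes `ψ` if its Lindblad operators
annihilate `ψ` and every vector orthogonal to `ψ` is sent by one of them to a vector with a
component along `ψ`: the infidelity then decays exponentially. -/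
theorem isGAS_of_reach (hψ : ‖ψ‖ = 1) (hL : ∀ k, L k *ᵥ WithLp.ofLp ψ = 0)
    (hpos : ∃ c : ℝ, ∀ ρ : Matrix ι ι ℂ, ρ.PosSemidef →
      (lindbladian 0 L ρ + (c : ℂ) • ρ).PosSemidef)
    (hreach : ∀ φ : ι → ℂ, φ ≠ 0 → star (WithLp.ofLp ψ) ⬝ᵥ φ = 0 →
      ∃ k, star (WithLp.ofLp ψ) ⬝ᵥ (L k *ᵥ φ) ≠ 0) :
    IsGAS (lindbladian 0 L) (pureState ψ) := by
  refine ⟨lindbladian_zero_pureState hL, fun ρ₀ hρ₀ => ?_⟩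
  obtain ⟨ε, hε, hrate⟩ := exists_pos_le_trace_pureState_mul_lindbladian hψ hL hreach
  -- The scalar may be increased, so that `c - ε` is nonnegative.
  obtain ⟨c, hεc, hc⟩ : ∃ c : ℝ, ε ≤ c ∧ ∀ ρ : Matrix ι ι ℂ, ρ.PosSemidef →
      ((lindbladian 0 L + (c : ℂ) • 1) ρ).PosSemidef := by
    obtain ⟨c, hc⟩ := hpos
    refine ⟨max c ε, le_max_right _ _, fun ρ hρ => ?_⟩
    have h : (lindbladian 0 L + ((max c ε : ℝ) : ℂ) • 1) ρ =
        lindbladian 0 L ρ + (c : ℂ) • ρ + ((max c ε - c : ℝ) : ℂ) • ρ := by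
      rw [LinearMap.add_apply, LinearMap.smul_apply, Module.End.one_apply, Complex.ofReal_sub]
      module
    rw [h]
    refine (hc ρ hρ).add (hρ.smul ?_)
    exact_mod_cast sub_nonneg.2 (le_max_left _ _)
  have hrate' : ∀ ρ : Matrix ι ι ℂ, ρ.PosSemidef →
      infidelity ψ (lindbladian 0 L ρ) ≤ -(ε * infidelity ψ ρ) := by
    intro ρ hρ
    have h := hrate ρ hρ
    rw [infidelity_apply, infidelity_apply, trace_lindbladian_zero, zero_sub, Complex.neg_re]
    exact neg_le_neg h
  let _ : NormedAddCommGroup (Matrix ι ι ℂ) := Matrix.frobeniusNormedAddCommGroup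
  refine tendsto_iff_norm_sub_tendsto_zero.2 ?_
  have hlim : Filter.Tendsto (fun t : ℝ => Real.sqrt (2 * (Real.exp (-(ε * t)) *
      infidelity ψ ρ₀))) Filter.atTop (nhds 0) := by
    have h1 : Filter.Tendsto (fun t : ℝ => Real.exp (-(ε * t))) Filter.atTop (nhds 0) :=
      Real.tendsto_exp_neg_atTop_nhds_zero.comp (Filter.tendsto_id.const_mul_atTop hε)
    have h2 := ((h1.mul_const (infidelity ψ ρ₀)).const_mul 2).sqrt
    rwa [zero_mul, mul_zero, Real.sqrt_zero] at h2
  refine squeeze_zero' (Filter.Eventually.of_forall fun t => norm_nonneg _) ?_ hlim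
  filter_upwards [Filter.eventually_ge_atTop 0] with t ht
  have hdens := isDensity_evolve (trace_lindbladian_zero L) hc hρ₀ ht
  refine Real.le_sqrt_of_sq_le ((norm_sub_pureState_sq_le hψ hdens).trans ?_)
  have h := infidelity_evolve_le hεc hc hrate' hρ₀.1 ht
  rw [infidelity_apply, hdens.2, Complex.sub_re, Complex.one_re] at h
  linarith

end Evolution

/-! ### Dissipation into the support of a reduced state -/

section Local

variable {ι n m : Type*} [Fintype ι] [Fintype n] [Fintype m] [DecidableEq ι] [DecidableEq m]

set_option synthInstance.maxHeartbeats 200000 in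
/-- The matrix of the orthogonal projection onto `Kᗮ`. -/
lemma exists_projection_ker_eq (K : Submodule ℂ (EuclideanSpace ℂ ι)) :
    ∃ R : Matrix ι ι ℂ, Rᴴ = R ∧ R * R = R ∧ ∀ v : ι → ℂ, R *ᵥ v = 0 ↔ WithLp.toLp 2 v ∈ K := by
  have hp := isStarProjection_starProjection (U := Kᗮ)
  refine ⟨(toEuclideanCLM (n := ι) (𝕜 := ℂ)).symm Kᗮ.starProjection, ?_, ?_, fun v => ?_⟩
  · rw [← star_eq_conjTranspose, ← map_star, hp.isSelfAdjoint.star_eq]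
  · rw [← map_mul, hp.isIdempotentElem.eq]
  · have h : ((toEuclideanCLM (n := ι) (𝕜 := ℂ)).symm Kᗮ.starProjection) *ᵥ v =
        WithLp.ofLp (Kᗮ.starProjection (WithLp.toLp 2 v)) := by
      rw [← ofLp_toEuclideanCLM, StarAlgEquiv.apply_symm_apply]
    rw [h, WithLp.ofLp_eq_zero, Submodule.starProjection_apply_eq_zero_iff,
      Submodule.orthogonal_orthogonal]

/-- The operator `X ⊗ 1` on `ℂⁿ ⊗ ℂᵐ`, read through the identification `e`. -/
def localOp (e : n × m ≃ ι) (X : Matrix n n ℂ) : Matrix ι ι ℂ :=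
  (X ⊗ₖ (1 : Matrix m m ℂ)).submatrix e.symm e.symm

variable (e : n × m ≃ ι)

omit [DecidableEq ι] in
lemma localOp_mulVec (X : Matrix n n ℂ) (φ : ι → ℂ) (x : n) (k : m) :
    (localOp e X *ᵥ φ) (e (x, k)) = (X *ᵥ fun y => φ (e (y, k))) x := by
  simp only [mulVec, dotProduct, localOp, submatrix_apply, Equiv.symm_apply_apply]
  rw [← e.sum_comp, Fintype.sum_prod_type]
  refine Finset.sum_congr rfl fun y _ => ?_
  simp [kroneckerMap_apply, Matrix.one_apply]

omit [DecidableEq ι] in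
lemma localOp_mul (X Y : Matrix n n ℂ) : localOp e (X * Y) = localOp e X * localOp e Y := by
  rw [localOp, localOp, localOp, submatrix_mul_equiv, ← mul_kronecker_mul, Matrix.one_mul]

omit [Fintype ι] [Fintype n] [Fintype m] [DecidableEq ι] in
lemma localOp_conjTranspose (X : Matrix n n ℂ) : (localOp e X)ᴴ = localOp e Xᴴ := by
  rw [localOp, localOp, conjTranspose_submatrix, conjTranspose_kronecker, conjTranspose_one]

omit [Fintype ι] [Fintype n] [Fintype m] in
lemma localOp_one [DecidableEq n] : localOp e (1 : Matrix n n ℂ) = 1 := by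
  rw [localOp, one_kronecker_one, submatrix_one_equiv]

omit [Fintype ι] [Fintype n] [Fintype m] [DecidableEq ι] in
lemma localOp_sum {s : Type*} [Fintype s] (X : s → Matrix n n ℂ) :
    localOp e (∑ i, X i) = ∑ i, localOp e (X i) := by
  ext x y
  simp [localOp, Matrix.sum_apply, kroneckerMap_apply, Finset.sum_mul]

omit [Fintype n] [Fintype m] [DecidableEq ι] [DecidableEq m] in
/-- The dissipators of a projection `R` and of `F i * R`, with `∑ i, F i† F i = 1`, add up to
`ρ ↦ (1 - R) ρ (1 - R) + ∑ i, F i R ρ R F i† - ρ`: no Hamiltonian term is left over. -/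
lemma sum_dissipator_projection {s : Type*} [Fintype s] [DecidableEq ι] {R : Matrix ι ι ℂ}
    (hR : Rᴴ = R) (hRR : R * R = R) {F : s → Matrix ι ι ℂ} (hF : ∑ i, (F i)ᴴ * F i = 1)
    (ρ : Matrix ι ι ℂ) :
    (R * ρ * Rᴴ - (1 / 2 : ℂ) • (Rᴴ * R * ρ + ρ * (Rᴴ * R))) +
      ∑ i, (F i * R * ρ * (F i * R)ᴴ - (1 / 2 : ℂ) • ((F i * R)ᴴ * (F i * R) * ρ +
        ρ * ((F i * R)ᴴ * (F i * R)))) + ρ =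
    (1 - R) * ρ * (1 - R)ᴴ + ∑ i, F i * R * ρ * (F i * R)ᴴ := by
  have h1 : ∑ i, (F i * R)ᴴ * (F i * R) = R := by
    calc ∑ i, (F i * R)ᴴ * (F i * R) = R * (∑ i, (F i)ᴴ * F i) * R := by
          rw [Finset.mul_sum, Finset.sum_mul]
          refine Finset.sum_congr rfl fun i _ => ?_
          rw [conjTranspose_mul, hR]
          simp only [Matrix.mul_assoc]
      _ = R := by rw [hF, Matrix.mul_one, hRR]
  rw [Finset.sum_sub_distrib, ← Finset.smul_sum, Finset.sum_add_distrib, ← Finset.sum_mul,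
    ← Finset.mul_sum, h1, conjTranspose_sub, conjTranspose_one, hR, hRR]
  simp only [sub_mul, mul_sub, Matrix.one_mul, Matrix.mul_one]
  module

/-- Suitably normalized, the matrix units are the Kraus operators of a channel. -/
lemma exists_sum_single_conjTranspose_mul_single [DecidableEq n] [Nonempty n] :
    ∃ s : ℂ, s ≠ 0 ∧ ∑ p : n × n, (s • single p.1 p.2 (1 : ℂ))ᴴ * (s • single p.1 p.2 (1 : ℂ)) =
      1 := by
  have hn : (0 : ℝ) < Fintype.card n := by exact_mod_cast Fintype.card_pos
  refine ⟨((Real.sqrt (Fintype.card n))⁻¹ : ℝ), ?_, ?_⟩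
  · exact_mod_cast (inv_pos.2 (Real.sqrt_pos.2 hn)).ne'
  · have hs : (((Real.sqrt (Fintype.card n))⁻¹ : ℝ) : ℂ) *
        (((Real.sqrt (Fintype.card n))⁻¹ : ℝ) : ℂ) * (Fintype.card n : ℂ) = 1 := by
      have : (Real.sqrt (Fintype.card n))⁻¹ * (Real.sqrt (Fintype.card n))⁻¹ *
          (Fintype.card n : ℝ) = 1 := by
        rw [← mul_inv, Real.mul_self_sqrt hn.le, inv_mul_cancel₀ hn.ne']
      exact_mod_cast this
    simp only [conjTranspose_smul, conjTranspose_single, Matrix.smul_mul, Matrix.mul_smul,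
      smul_smul, single_mul_single_same, Fintype.sum_prod_type, Finset.sum_const, star_one, mul_one,
      RCLike.star_def, Complex.conj_ofReal, Finset.card_univ]
    rw [← Finset.smul_sum, sum_single_one, ← Nat.cast_smul_eq_nsmul ℂ, smul_smul,
      mul_comm, hs, one_smul]

/-- Local dissipation on the factor `ℂⁿ` of `ℂⁿ ⊗ ℂᵐ`: if the reduced state of `ψ` on `ℂᵐ` has full
rank, there are local operators annihilating `ψ` such that the only vectors not pumped towards `ψ`
are those of the form `(1 ⊗ X) ψ`, that is, those whose reduced state on `ℂⁿ` is supported in the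
support of that of `ψ`. -/
theorem exists_local_dissipators [DecidableEq n] [Nonempty n] (ψ : ι → ℂ)
    (hfull : ∀ η : m → ℂ, (∀ x, ∑ k, ψ (e (x, k)) * η k = 0) → η = 0) :
    ∃ L : Option (n × n) → Matrix ι ι ℂ,
      (∀ o, ∃ X, L o = localOp e X) ∧ (∀ o, L o *ᵥ ψ = 0) ∧
      (∀ ρ : Matrix ι ι ℂ, ρ.PosSemidef → (∑ o, (L o * ρ * (L o)ᴴ -
        (1 / 2 : ℂ) • ((L o)ᴴ * L o * ρ + ρ * ((L o)ᴴ * L o))) + ρ).PosSemidef) ∧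
      ∀ φ : ι → ℂ, (∀ o, star ψ ⬝ᵥ (L o *ᵥ φ) = 0) →
        ∃ X : Matrix m m ℂ, ∀ x k, φ (e (x, k)) = ∑ k', ψ (e (x, k')) * X k' k := by
  let K : Submodule ℂ (EuclideanSpace ℂ n) :=
    Submodule.span ℂ (Set.range fun k : m => WithLp.toLp 2 fun x => ψ (e (x, k)))
  obtain ⟨R, hR, hRR, hker⟩ := exists_projection_ker_eq K
  obtain ⟨s, hs, hsum⟩ := exists_sum_single_conjTranspose_mul_single (n := n)
  have hRψ : localOp e R *ᵥ ψ = 0 := by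
    ext i
    obtain ⟨⟨x, k⟩, rfl⟩ := e.surjective i
    rw [localOp_mulVec, (hker _).2 (Submodule.subset_span ⟨k, rfl⟩)]
    rfl
  have hR' : (localOp e R)ᴴ = localOp e R := by rw [localOp_conjTranspose, hR]
  have hRR' : localOp e R * localOp e R = localOp e R := by rw [← localOp_mul, hRR]
  have hF : ∑ p : n × n, (localOp e (s • single p.1 p.2 (1 : ℂ)))ᴴ *
      localOp e (s • single p.1 p.2 (1 : ℂ)) = 1 := by
    simp only [localOp_conjTranspose, ← localOp_mul]
    rw [← localOp_sum, hsum, localOp_one]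
  refine ⟨fun o => o.elim (localOp e R)
    fun p => localOp e (s • single p.1 p.2 (1 : ℂ)) * localOp e R, ?_, ?_, ?_, ?_⟩
  · rintro (_ | p)
    · exact ⟨_, rfl⟩
    · exact ⟨_, (localOp_mul e _ _).symm⟩
  · rintro (_ | p)
    · exact hRψ
    · simp [← mulVec_mulVec, hRψ]
  · intro ρ hρ
    rw [Fintype.sum_option]
    simp only [Option.elim]
    rw [sum_dissipator_projection hR' hRR' hF]
    exact (hρ.mul_mul_conjTranspose_same _).add
      (posSemidef_sum _ fun p _ => hρ.mul_mul_conjTranspose_same _)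
  · intro φ hφ
    have hχ : localOp e R *ᵥ φ = 0 := by
      set χ := localOp e R *ᵥ φ with hχ
      have h1 : ∀ x y, ∑ k, star (ψ (e (x, k))) * χ (e (y, k)) = 0 := by
        intro x y
        have h := hφ (some (x, y))
        simp only [Option.elim, ← mulVec_mulVec, ← hχ] at h
        rw [dotProduct, ← e.sum_comp, Fintype.sum_prod_type, Finset.sum_comm] at h
        simp only [localOp_mulVec, smul_mulVec, Pi.smul_apply, single_mulVec, Pi.star_apply,
          smul_eq_mul, one_mul, Function.update_apply, Pi.zero_apply, mul_ite, mul_zero,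
          Finset.sum_ite_eq', Finset.mem_univ, if_true] at h
        simp only [mul_left_comm _ s, ← Finset.mul_sum] at h
        exact (mul_eq_zero.1 h).resolve_left hs
      ext i
      obtain ⟨⟨y, k⟩, rfl⟩ := e.surjective i
      have h2 := hfull (fun k => star (χ (e (y, k)))) fun x => by
        have := congrArg star (h1 x y)
        simpa [star_sum] using this
      exact star_eq_zero.1 (congrFun h2 k)
    have hmem : ∀ k, WithLp.toLp 2 (fun x => φ (e (x, k))) ∈ K := by
      intro k
      refine (hker _).1 ?_
      ext x
      rw [← localOp_mulVec, hχ]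
      rfl
    choose X hX using fun k => (Submodule.mem_span_range_iff_exists_fun ℂ).1 (hmem k)
    refine ⟨Matrix.of fun k' k => X k k', fun x k => ?_⟩
    have h := congrFun (congrArg WithLp.ofLp (hX k)) x
    simp only [WithLp.ofLp_sum, Finset.sum_apply, WithLp.ofLp_smul, Pi.smul_apply, smul_eq_mul] at h
    rw [← h]
    exact Finset.sum_congr rfl fun k' _ => mul_comm _ _

end Local

/-! ### Bricks are stabilizable -/

section Brick

variable {a b c : Type*} [Fintype a] [Fintype b] [Fintype c] [DecidableEq a] [DecidableEq b]
  [DecidableEq c]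

/-- Slicing a tensor in `ℂᵃ ⊗ ℂᵇ ⊗ ℂᶜ` along the middle factor gives a family of `a × c` matrices
`T j`, that is, a representation of the generalized Kronecker quiver with arrows `b`. The tensor is a
*brick* if the only endomorphisms `(Y, X)` of this representation, `Y * T j = T j * X` for all `j`,
are the scalars. -/
def IsBrick (ψ : a × b × c → ℂ) : Prop :=
  ∀ (Y : Matrix a a ℂ) (X : Matrix c c ℂ),
    (∀ i j k, ∑ i', Y i i' * ψ (i', j, k) = ∑ k', ψ (i, j, k') * X k' k) →
      ∃ z : ℂ, Y = z • 1 ∧ X = z • 1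

omit [Fintype b] [DecidableEq b] in
/-- The reduced state of a brick on the last factor has full rank: a vector `η` killed by all slices
gives the endomorphism `(0, η ⊗ (1, …, 1))`, which is scalar only for `η = 0`. -/
lemma IsBrick.eq_zero_of_sum_right [Nonempty a] {ψ : a × b × c → ℂ} (h : IsBrick ψ) (η : c → ℂ)
    (hη : ∀ i j, ∑ k, ψ (i, j, k) * η k = 0) : η = 0 := by
  obtain ⟨z, h0, hX⟩ := h 0 (Matrix.of fun k _ => η k) fun i j k => by simp [hη]
  have hz : z = 0 := by
    obtain ⟨i⟩ := ‹Nonempty a›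
    simpa using (congrFun (congrFun h0 i) i).symm
  ext k
  simpa [hz] using congrFun (congrFun hX k) k

omit [Fintype b] [DecidableEq b] in
lemma IsBrick.eq_zero_of_sum_left [Nonempty c] {ψ : a × b × c → ℂ} (h : IsBrick ψ) (η : a → ℂ)
    (hη : ∀ j k, ∑ i, ψ (i, j, k) * η i = 0) : η = 0 := by
  obtain ⟨z, hY, h0⟩ := h (Matrix.of fun _ i => η i) 0 fun i j k => by
    simpa [mul_comm] using hη j k
  have hz : z = 0 := by
    obtain ⟨k⟩ := ‹Nonempty c›
    simpa using (congrFun (congrFun h0 k) k).symm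
  ext i
  simpa [hz] using congrFun (congrFun hY i) i

/-- A vector that is not pumped towards `ψ` by either neighborhood has the form `(1 ⊗ X) ψ` as well
as `(Y ⊗ 1) ψ`; for a brick it is a multiple of `ψ`. -/
theorem IsBrick.isDQLS [Nonempty a] [Nonempty b] [Nonempty c] {ψ : EuclideanSpace ℂ (a × b × c)}
    (h : IsBrick (WithLp.ofLp ψ)) (hψ : ‖ψ‖ = 1) : IsDQLS (nTri a b c) ψ := by
  let e₁ : (a × b) × c ≃ a × b × c := Equiv.prodAssoc a b c
  let e₂ : (b × c) × a ≃ a × b × c := Equiv.prodComm (b × c) a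
  obtain ⟨L₁, hloc₁, hz₁, hpos₁, hreach₁⟩ := exists_local_dissipators e₁ (WithLp.ofLp ψ)
    fun η hη => h.eq_zero_of_sum_right η fun i j => hη (i, j)
  obtain ⟨L₂, hloc₂, hz₂, hpos₂, hreach₂⟩ := exists_local_dissipators e₂ (WithLp.ofLp ψ)
    fun η hη => h.eq_zero_of_sum_left η fun j k => hη (j, k)
  let κ := Option ((a × b) × (a × b)) ⊕ Option ((b × c) × (b × c))
  let f : Fin (Fintype.card κ) ≃ κ := (Fintype.equivFin κ).symm
  let L : κ → Matrix (a × b × c) (a × b × c) ℂ := Sum.elim L₁ L₂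
  have hz : ∀ o, L o *ᵥ WithLp.ofLp ψ = 0 := by
    rintro (o | o)
    · exact hz₁ o
    · exact hz₂ o
  refine ⟨_, L ∘ f, fun k => ?_, fun k => hz _, isGAS_of_reach hψ (fun k => hz _)
    ⟨2, fun ρ hρ => ?_⟩ fun φ hφ hψφ => ?_⟩
  · rw [Function.comp_apply]
    rcases f k with o | o
    · exact ⟨_, Set.mem_insert _ _, hloc₁ o⟩
    · refine ⟨_, Set.mem_insert_of_mem _ rfl, ?_⟩
      obtain ⟨X, hX⟩ := hloc₂ o
      refine ⟨X, hX.trans ?_⟩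
      ext x y
      exact mul_comm _ _
  · rw [lindbladian_zero_apply]
    simp only [Function.comp_apply]
    rw [f.sum_comp fun o => L o * ρ * (L o)ᴴ -
        (1 / 2 : ℂ) • ((L o)ᴴ * L o * ρ + ρ * ((L o)ᴴ * L o)), Fintype.sum_sum_type]
    convert (hpos₁ ρ hρ).add (hpos₂ ρ hρ) using 1
    simp only [L, Sum.elim_inl, Sum.elim_inr, Complex.ofReal_ofNat]
    module
  · by_contra! hcon
    have hcon' : ∀ o, star (WithLp.ofLp ψ) ⬝ᵥ (L o *ᵥ φ) = 0 := fun o => by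
      simpa using hcon (f.symm o)
    obtain ⟨X, hX⟩ := hreach₁ φ fun o => hcon' (Sum.inl o)
    obtain ⟨Y, hY⟩ := hreach₂ φ fun o => hcon' (Sum.inr o)
    obtain ⟨z, -, hz⟩ := h Yᵀ X fun i j k => by
      have h1 := hX (i, j) k
      have h2 := hY (j, k) i
      refine Eq.trans ?_ (h2.symm.trans h1)
      exact Finset.sum_congr rfl fun i' _ => mul_comm _ _
    have hφz : φ = z • WithLp.ofLp ψ := by
      ext ⟨i, j, k⟩
      refine (hX (i, j) k).trans ?_
      simp [hz, Matrix.one_apply, e₁, mul_comm]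
    rw [hφz, dotProduct_smul, star_dotProduct_self hψ, smul_eq_mul, mul_one] at hψφ
    exact hφ (by rw [hφz, hψφ, zero_smul])

end Brick

/-! ### Genericity of bricks -/

section Generic

variable {a b c : Type*} [Fintype a] [Fintype c]

/-- The linear map sending a pair `(Y, X)` to the family of matrices `Y * T j - T j * X`, where `T j`
are the slices of `ψ`, and to the number `s * Y i₀ i₀`, as a linear function of `(ψ, s)`. -/
def intertwiner (b : Type*) (i₀ : a) : (EuclideanSpace ℂ (a × b × c) × ℂ) →ₗ[ℂ]
    ((a → a → ℂ) × (c → c → ℂ)) →ₗ[ℂ] ((a × b × c → ℂ) × ℂ) :=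
  LinearMap.mk₂ ℂ (fun ψ p => (fun x => ∑ i', p.1 x.1 i' * ψ.1 (i', x.2.1, x.2.2) -
      ∑ k', ψ.1 (x.1, x.2.1, k') * p.2 k' x.2.2, ψ.2 * p.1 i₀ i₀))
    (fun ψ ψ' p => by
      refine Prod.ext (funext fun x => ?_) ?_
      · simp only [Prod.fst_add, PiLp.add_apply, mul_add, add_mul, Finset.sum_add_distrib,
          Pi.add_apply]
        ring
      · simp [add_mul])
    (fun z ψ p => by
      refine Prod.ext (funext fun x => ?_) ?_
      · simp [Finset.mul_sum, mul_sub, mul_left_comm, mul_assoc]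
      · simp [mul_assoc])
    (fun ψ p p' => by
      refine Prod.ext (funext fun x => ?_) ?_
      · simp only [Prod.fst_add, Prod.snd_add, mul_add, add_mul, Finset.sum_add_distrib,
          Pi.add_apply]
        ring
      · simp [mul_add])
    (fun z ψ p => by
      refine Prod.ext (funext fun x => ?_) ?_
      · simp [Finset.mul_sum, mul_sub, mul_left_comm, mul_assoc]
      · simp [mul_left_comm])

/-- The second component of `intertwiner` does not vanish on the nonzero scalar pairs, which the
first component annihilates, so that injectivity singles out the bricks. -/
lemma injective_intertwiner_iff [DecidableEq a] [DecidableEq c] (i₀ : a)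
    (ψ : EuclideanSpace ℂ (a × b × c)) {s : ℂ} (hs : s ≠ 0) :
    Function.Injective (intertwiner b i₀ (ψ, s)) ↔ IsBrick (WithLp.ofLp ψ) := by
  have happ : ∀ p, intertwiner b i₀ (ψ, s) p =
      (fun x => ∑ i', p.1 x.1 i' * ψ (i', x.2.1, x.2.2) -
        ∑ k', ψ (x.1, x.2.1, k') * p.2 k' x.2.2, s * p.1 i₀ i₀) := fun _ => rfl
  rw [← LinearMap.ker_eq_bot, LinearMap.ker_eq_bot']
  constructor
  · intro h Y X hYX
    have h0 := h (Y - Y i₀ i₀ • (1 : Matrix a a ℂ), X - Y i₀ i₀ • (1 : Matrix c c ℂ)) (by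
      rw [happ]
      refine Prod.ext (funext fun x => ?_) ?_
      · simp only [Matrix.sub_apply, Matrix.smul_apply, Matrix.one_apply, sub_mul, mul_sub,
          Finset.sum_sub_distrib, hYX]
        simp [mul_comm]
      · simp)
    exact ⟨Y i₀ i₀, sub_eq_zero.1 (congrArg Prod.fst h0), sub_eq_zero.1 (congrArg Prod.snd h0)⟩
  · rintro h ⟨Y, X⟩ hp
    rw [happ] at hp
    obtain ⟨z, hY, hX⟩ := h Y X fun i j k =>
      sub_eq_zero.1 (congrFun (congrArg Prod.fst hp) (i, j, k))
    have hz : z = 0 := by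
      have h2 := (mul_eq_zero.1 (congrArg Prod.snd hp)).resolve_left hs
      change Y i₀ i₀ = 0 at h2
      simpa [hY] using h2
    rw [hz, zero_smul] at hY hX
    rw [hY, hX]
    rfl

variable [Fintype b] [DecidableEq a] [DecidableEq c]

lemma isOpen_setOf_isBrick [Nonempty a] :
    IsOpen {ψ : EuclideanSpace ℂ (a × b × c) | IsBrick (WithLp.ofLp ψ)} := by
  obtain ⟨i₀⟩ := ‹Nonempty a›
  let Φ : EuclideanSpace ℂ (a × b × c) → (((a → a → ℂ) × (c → c → ℂ)) →L[ℂ]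
      ((a × b × c → ℂ) × ℂ)) :=
    fun ψ => LinearMap.toContinuousLinearMap (intertwiner b i₀ (ψ, 1))
  have hΦ : Continuous Φ := by
    have h := (LinearMap.continuous_of_finiteDimensional
      ((LinearMap.toContinuousLinearMap : _ ≃ₗ[ℂ] (((a → a → ℂ) × (c → c → ℂ)) →L[ℂ]
        ((a × b × c → ℂ) × ℂ))).toLinearMap ∘ₗ intertwiner (c := c) b i₀))
    exact h.comp (by fun_prop : Continuous fun ψ : EuclideanSpace ℂ (a × b × c) => (ψ, (1 : ℂ)))
  convert ContinuousLinearMap.isOpen_injective.preimage hΦ using 1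
  ext ψ
  exact (injective_intertwiner_iff i₀ ψ one_ne_zero).symm

/-- If there is one brick, then almost every tensor is a brick. On each complex line
`t ↦ ψ + t • ψ₀` in the direction of a brick `ψ₀`, a nonzero `t` with `ψ + t • ψ₀` not a brick is
the negative of an eigenvalue of a fixed operator, so that there are finitely many. -/
theorem ae_isBrick [Nonempty a] {ψ₀ : EuclideanSpace ℂ (a × b × c)}
    (h : IsBrick (WithLp.ofLp ψ₀)) :
    ∀ᵐ ψ : EuclideanSpace ℂ (a × b × c), IsBrick (WithLp.ofLp ψ) := by
  refine ae_mem_of_ae_add_linearMap_mem (LinearMap.toSpanSingleton ℂ _ ψ₀)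
    (volume : Measure ℂ) volume isOpen_setOf_isBrick.measurableSet fun ψ => ?_
  obtain ⟨i₀⟩ := ‹Nonempty a›
  have hinj := (injective_intertwiner_iff i₀ ψ₀ one_ne_zero).2 h
  obtain ⟨B, hB⟩ := LinearMap.exists_leftInverse_of_injective _ (LinearMap.ker_eq_bot.2 hinj)
  let N : Module.End ℂ ((a → a → ℂ) × (c → c → ℂ)) := B ∘ₗ intertwiner b i₀ (ψ, 0)
  have hfin : ({0} ∪ Neg.neg '' {z : ℂ | N.HasEigenvalue z}).Finite :=
    (Set.finite_singleton 0).union (N.finite_hasEigenvalue.image _)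
  filter_upwards [measure_eq_zero_iff_ae_notMem.1 (hfin.measure_zero volume)] with t ht
  simp only [Set.mem_union, Set.mem_singleton_iff, Set.mem_image, not_or, not_exists,
    not_and] at ht
  have heq : ((ψ + t • ψ₀, t) : EuclideanSpace ℂ (a × b × c) × ℂ) = (ψ, 0) + t • (ψ₀, 1) := by
    ext <;> simp
  refine (injective_intertwiner_iff i₀ _ ht.1).1 ?_
  rw [LinearMap.toSpanSingleton_apply, heq, map_add, map_smul, ← LinearMap.ker_eq_bot,
    LinearMap.ker_eq_bot']
  intro p hp
  by_contra hp0
  have hBp : N p + t • p = 0 := by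
    have h1 := congrArg B hp
    rw [LinearMap.add_apply, LinearMap.smul_apply, map_add, map_smul, map_zero] at h1
    rwa [← LinearMap.comp_apply, ← LinearMap.comp_apply, hB] at h1
  refine ht.2 (-t) (Module.End.hasEigenvalue_of_hasEigenvector (x := p)
    ⟨Module.End.mem_eigenspace_iff.2 ?_, hp0⟩) (neg_neg t)
  rw [neg_smul]
  exact eq_neg_of_add_eq_zero_left hBp

omit [Fintype b] in
lemma IsBrick.of_smul {z : ℂ} {ψ : a × b × c → ℂ} (h : IsBrick (z • ψ)) :
    IsBrick ψ := by
  intro Y X hYX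
  refine h Y X fun i j k => ?_
  simp only [Pi.smul_apply, smul_eq_mul, mul_left_comm _ z, mul_assoc, ← Finset.mul_sum, hYX]

/-- A property of almost every vector that passes from `r • ψ` to `ψ` holds for almost every unit
vector. -/
lemma ae_randomPureState {ι : Type*} [Fintype ι] {S : Set (EuclideanSpace ℂ ι)}
    (hS : MeasurableSet S) (hsmul : ∀ (r : ℝ) ψ, r • ψ ∈ S → ψ ∈ S)
    (h : ∀ᵐ ψ : EuclideanSpace ℂ ι, ψ ∈ S) : ∀ᵐ ψ ∂randomPureState ι, ψ.1 ∈ S := by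
  refine Measure.ae_smul_measure ?_ _
  have hm : MeasurableSet {ψ : Metric.sphere (0 : EuclideanSpace ℂ ι) 1 | ψ.1 ∉ S} :=
    measurable_subtype_coe hS.compl
  refine (Measure.toSphere_apply' _ hm).trans ?_
  refine mul_eq_zero_of_right _ (measure_mono_null ?_ h)
  rintro _ ⟨r, -, _, ⟨ψ, hψ, rfl⟩, rfl⟩
  exact fun hmem => hψ (hsmul r _ hmem)

theorem genericallyDQLS_of_exists_isBrick {da db dc : ℕ} (hda : 1 ≤ da) (hdb : 1 ≤ db)
    (hdc : 1 ≤ dc) (h : ∃ ψ : Fin da × Fin db × Fin dc → ℂ, IsBrick ψ) :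
    GenericallyDQLS da db dc := by
  have : NeZero da := ⟨by omega⟩
  have : NeZero db := ⟨by omega⟩
  have : NeZero dc := ⟨by omega⟩
  obtain ⟨ψ₀, h₀⟩ := h
  have hae := ae_randomPureState isOpen_setOf_isBrick.measurableSet
    (fun r ψ hψ => IsBrick.of_smul (z := (r : ℂ)) hψ)
    (ae_isBrick (ψ₀ := WithLp.toLp 2 ψ₀) h₀)
  filter_upwards [hae] with ψ hψ
  exact IsBrick.isDQLS hψ (mem_sphere_zero_iff_norm.1 ψ.2)

end Generic

/-! ### Explicit bricks -/

section Examples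

variable {a b c : Type*} [Fintype a] [Fintype c] [DecidableEq a] [DecidableEq c]

/-- The definition of a brick in terms of the slices. -/
lemma isBrick_of_slices (T : b → Matrix a c ℂ)
    (h : ∀ (Y : Matrix a a ℂ) (X : Matrix c c ℂ), (∀ j, Y * T j = T j * X) →
      ∃ z : ℂ, Y = z • 1 ∧ X = z • 1) :
    IsBrick fun x : a × b × c => T x.2.1 x.1 x.2.2 := by
  intro Y X hYX
  refine h Y X fun j => ?_
  ext i k
  simpa [mul_apply] using hYX i j k

lemma IsBrick.comp_equiv {c' : Type*} [Fintype c'] [DecidableEq c'] {ψ : a × b × c → ℂ}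
    (h : IsBrick ψ) (e : c' ≃ c) : IsBrick fun x : a × b × c' => ψ (x.1, x.2.1, e x.2.2) := by
  intro Y X hYX
  obtain ⟨z, hY, hX⟩ := h Y (X.submatrix e.symm e.symm) fun i j k => by
    have := hYX i j (e.symm k)
    simp only [Equiv.apply_symm_apply] at this
    rw [this, ← e.sum_comp]
    simp
  refine ⟨z, hY, ?_⟩
  have := congrArg (fun M => M.submatrix e e) hX
  simpa [submatrix_smul] using this

/-- The diagonal matrix with entries `0, 1, …, d - 1`, chosen for being distinct. -/
def distinctDiagonal (d : ℕ) : Matrix (Fin d) (Fin d) ℂ := diagonal fun i => (i : ℂ)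

lemma eq_zero_of_commute_distinctDiagonal {d : ℕ} {Y : Matrix (Fin d) (Fin d) ℂ}
    (h : Y * distinctDiagonal d = distinctDiagonal d * Y) {i j : Fin d} (hij : i ≠ j) :
    Y i j = 0 := by
  have h1 := congrFun (congrFun h i) j
  rw [distinctDiagonal, mul_diagonal, diagonal_mul, mul_comm, ← sub_eq_zero, ← sub_mul] at h1
  refine (mul_eq_zero.1 h1).resolve_left (sub_ne_zero.2 fun hc => hij ?_)
  exact Fin.ext (by exact_mod_cast hc.symm)

/-- A matrix commuting with a diagonal matrix with distinct entries and with the all-ones matrix is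
scalar. -/
lemma exists_eq_smul_one_of_commute {d : ℕ} {Y : Matrix (Fin d) (Fin d) ℂ}
    (h₁ : Y * distinctDiagonal d = distinctDiagonal d * Y)
    (h₂ : Y * Matrix.of (fun _ _ => 1) = Matrix.of (fun _ _ => 1) * Y) : ∃ z : ℂ, Y = z • 1 := by
  rcases isEmpty_or_nonempty (Fin d) with hd | ⟨⟨i₀⟩⟩
  · exact ⟨0, Subsingleton.elim _ _⟩
  refine ⟨Y i₀ i₀, ?_⟩
  ext i j
  by_cases hij : i = j
  · subst hij
    have h := congrFun (congrFun h₂ i) i₀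
    simp only [mul_apply, of_apply, mul_one, one_mul] at h
    rw [Finset.sum_eq_single i (fun k _ hk => eq_zero_of_commute_distinctDiagonal h₁ hk.symm)
      (by simp), Finset.sum_eq_single i₀ (fun k _ hk => eq_zero_of_commute_distinctDiagonal h₁ hk)
      (by simp)] at h
    simp [h]
  · simp [eq_zero_of_commute_distinctDiagonal h₁ hij, hij]

/-- Slices `1`, `D` and `J, …, J`, with `D` diagonal with distinct entries and `J` the all-ones
matrix. -/
lemma exists_isBrick_square (d : ℕ) {db : ℕ} (hdb : 2 < db) :
    ∃ ψ : Fin d × Fin db × Fin d → ℂ, IsBrick ψ := by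
  let T : Fin db → Matrix (Fin d) (Fin d) ℂ := fun j =>
    if j.1 = 0 then 1 else if j.1 = 1 then distinctDiagonal d else Matrix.of fun _ _ => 1
  refine ⟨_, isBrick_of_slices T fun Y X h => ?_⟩
  have h0 : Y = X := by simpa [T] using h ⟨0, by omega⟩
  subst h0
  obtain ⟨z, hz⟩ := exists_eq_smul_one_of_commute (Y := Y) (by simpa [T] using h ⟨1, by omega⟩)
    (by simpa [T] using h ⟨2, hdb⟩)
  exact ⟨z, hz, hz⟩

/-- Slices `[1 0]`, `[D 0]` and `[0 w], …, [0 w]`, with `D` diagonal with distinct entries and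
`w` the all-ones column. -/
lemma exists_isBrick_succ (d : ℕ) {db : ℕ} (hd : 1 ≤ d) (hdb : 2 < db) :
    ∃ ψ : Fin d × Fin db × Fin (d + 1) → ℂ, IsBrick ψ := by
  let T : Fin db → Matrix (Fin d) (Fin d ⊕ Fin 1) ℂ := fun j =>
    if j.1 = 0 then fromCols 1 0 else if j.1 = 1 then fromCols (distinctDiagonal d) 0
      else fromCols 0 (Matrix.of fun _ _ => 1)
  refine ⟨_, (isBrick_of_slices T fun Y X h => ?_).comp_equiv finSumFinEquiv.symm⟩
  obtain ⟨A, B, C, D, rfl⟩ : ∃ A B C D, X = fromBlocks A B C D :=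
    ⟨_, _, _, _, (fromBlocks_toBlocks X).symm⟩
  have h0 := h ⟨0, by omega⟩
  have h1 := h ⟨1, by omega⟩
  have h2 := h ⟨2, hdb⟩
  simp only [T, mul_fromCols, fromCols_mul_fromBlocks, fromCols_inj.eq_iff, if_true, if_false,
    one_ne_zero, OfNat.ofNat_ne_zero, OfNat.ofNat_ne_one, Matrix.mul_one, Matrix.one_mul,
    Matrix.mul_zero, Matrix.zero_mul, add_zero, zero_add] at h0 h1 h2
  obtain ⟨rfl, rfl⟩ := h0
  have hC : C = 0 := by
    ext u i
    have := congrFun (congrFun h2.1 ⟨0, hd⟩) i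
    simpa [mul_apply, Subsingleton.elim u 0] using this.symm
  have hY : Y = D 0 0 • 1 := by
    ext i j
    by_cases hij : i = j
    · subst hij
      have := congrFun (congrFun h2.2 i) 0
      simp only [mul_apply, of_apply, mul_one, one_mul, Fin.sum_univ_one] at this
      rw [Finset.sum_eq_single i
        (fun k _ hk => eq_zero_of_commute_distinctDiagonal h1.1 hk.symm) (by simp)] at this
      simp [this]
    · simp [eq_zero_of_commute_distinctDiagonal h1.1 hij, hij]
  have hD : D = D 0 0 • 1 := by
    ext u v
    simp [Subsingleton.elim u 0, Subsingleton.elim v 0]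
  refine ⟨D 0 0, hY, ?_⟩
  rw [← fromBlocks_one, fromBlocks_smul, smul_zero, smul_zero, ← hY, ← hD, hC]

/-- With `1 < n < db`, the first `n` slices embed `ℂᵈ` as the `n` blocks, and the others consist of
the blocks `D, J, …, J`, with `D` diagonal with distinct entries and `J` the all-ones matrix. -/
lemma exists_isBrick_mul (d : ℕ) {db n : ℕ} (hn : 1 < n) (hdb : n < db) :
    ∃ ψ : Fin d × Fin db × Fin (n * d) → ℂ, IsBrick ψ := by
  let G : Fin n → Matrix (Fin d) (Fin d) ℂ := fun l =>
    if l.1 = 0 then distinctDiagonal d else Matrix.of fun _ _ => 1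
  let T : Fin db → Matrix (Fin d) (Fin n × Fin d) ℂ := fun j =>
    if j.1 < n then Matrix.of fun i k => if k.1.1 = j.1 ∧ k.2 = i then 1 else 0
      else Matrix.of fun i k => G k.1 i k.2
  refine ⟨_, (isBrick_of_slices T fun Y X h => ?_).comp_equiv finProdFinEquiv.symm⟩
  have hX : ∀ l l' i i', X (l, i) (l', i') = if l = l' then Y i i' else 0 := by
    intro l l' i i'
    have h1 := congrFun (congrFun (h ⟨l.1, l.2.trans hdb⟩) i) (l', i')
    simp only [T, l.2, if_true, mul_apply, of_apply, Fintype.sum_prod_type, Fin.val_inj, ite_and,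
      ite_mul, mul_ite, one_mul, mul_one, zero_mul, mul_zero] at h1
    simp at h1
    rw [← h1]
    simp [eq_comm]
  have hG : ∀ l, Y * G l = G l * Y := by
    intro l
    ext i i'
    have h1 := congrFun (congrFun (h ⟨n, hdb⟩) i) (l, i')
    simp only [T, lt_irrefl, if_false, mul_apply, of_apply, Fintype.sum_prod_type, hX, mul_ite,
      mul_zero] at h1
    rw [Finset.sum_comm] at h1
    simpa [mul_apply] using h1
  obtain ⟨z, hz⟩ := exists_eq_smul_one_of_commute (Y := Y)
    (by simpa [G] using hG ⟨0, by omega⟩) (by simpa [G] using hG ⟨1, hn⟩)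
  refine ⟨z, hz, ?_⟩
  ext ⟨l, i⟩ ⟨l', i'⟩
  rw [hX, hz]
  simp only [Matrix.smul_apply, Matrix.one_apply, Prod.mk.injEq, ite_and]
  split_ifs <;> simp

end Examples

end QuasiLocal

end

theorem theorem3p10 (da db : ℕ) (hda : 1 ≤ da) (hdb : 2 < db) :
    QuasiLocal.GenericallyDQLS da db da ∧
    QuasiLocal.GenericallyDQLS da db (da + 1) ∧
    ∀ n : ℕ, 1 < n → n < db → QuasiLocal.GenericallyDQLS da db (n * da) := by
  have hdb' : 1 ≤ db := by omega
  refine ⟨?_, ?_, fun n hn hnb => ?_⟩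
  · exact QuasiLocal.genericallyDQLS_of_exists_isBrick hda hdb' hda
      (QuasiLocal.exists_isBrick_square da hdb)
  · exact QuasiLocal.genericallyDQLS_of_exists_isBrick hda hdb' (by omega)
      (QuasiLocal.exists_isBrick_succ da hda hdb)
  · exact QuasiLocal.genericallyDQLS_of_exists_isBrick hda hdb'
      (Nat.mul_pos (by omega) hda) (QuasiLocal.exists_isBrick_mul da hn hnb)
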